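/- \textbf{Theorem (Non-dissipation theorem).} Let $(F,d_F)$ be a compact, connected and locally connected metric space, and let $\mu_F$ be a Borel probability measure on $F$ with full support, $\operatorname{supp}\mu_F=F$. For $n\ge 1$ let $F^n$ be the $n$-fold product with the metric $d_{l_\infty}(x,y)=\max_{1\le i\le n} d_F(x_i,y_i)$ and the product measure $\mu_F^{\otimes n}$. Then, for every real number $\delta>0$, the sequence $\{(F^n,d_{l_\infty},\mu_F^{\otimes n})\}_{n=1}^\infty$ does not $\delta$-dissipate. Here, for a complete separable metric space $(X,d_X)$ with a Borel probability measure $\mu_X$, and for real numbers $\kappa_0,\dots,\kappa_N>0$ with $N\ge 1$, the separation distance $\operatorname{Sep}(X;\kappa_0,\dots,\kappa_N)$ is the supremum of $\min_{i\ne j} d_X(A_i,A_j)$ over all Borel sets $A_0,\dots,A_N\subset X$ with $\mu_X(A_i)\ge\kappa_i$ for all $i$, where $d_X(A_i,A_j)=\inf_{x\in A_i,\,y\in A_j}d_X(x,y)$ (and it is $0$ if there are no such sets). A sequence $\{X_n\}$ of such spaces $\delta$-dissipates if \[ \liminf_{n\to\infty}\operatorname{Sep}(X_n;\kappa_0,\dots,\kappa_N)\ge\delta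 \] for all $N\ge 1$ and all $\kappa_0,\dots,\kappa_N>0$ with $\sum_{i=0}^N\kappa_i<1$. -/

import Mathlib

open MeasureTheory Filter
open scoped ENNReal

/-- The distance `inf {d(x, y) | x ∈ A, y ∈ B}` between two subsets of a metric space,
as an extended nonnegative real. -/
noncomputable def setDistance {X : Type*} [MetricSpace X] (A B : Set X) : ℝ≥0∞ :=
  ⨅ x ∈ A, ⨅ y ∈ B, edist x y

/-- The separation distance `Sep(X; κ₀, …, κ_N)` of a metric measure space: the supremum of
`min_{i ≠ j} d(A_i, A_j)` over all families of Borel sets `A₀, …, A_N` with `μ(A_i) ≥ κ_i`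
(it is `0` if there is no such family). It is used for `N ≥ 1` and `κ_i > 0`. -/
noncomputable def separationDistance {X : Type*} [MetricSpace X] [MeasurableSpace X]
    (μ : Measure X) {N : ℕ} (κ : Fin (N + 1) → ℝ) : ℝ≥0∞ :=
  ⨆ (A : Fin (N + 1) → Set X)
    (_ : ∀ i, MeasurableSet (A i) ∧ ENNReal.ofReal (κ i) ≤ μ (A i)),
    ⨅ (i : Fin (N + 1)) (j : Fin (N + 1)) (_ : i ≠ j), setDistance (A i) (A j)

/-- A sequence of metric measure spaces `(X n, d, μ n)` `δ`-dissipates if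
`liminf_n Sep(X n; κ₀, …, κ_N) ≥ δ` for all `N ≥ 1` and all `κ₀, …, κ_N > 0` with
`∑ κ_i < 1`. -/
def Dissipates (X : ℕ → Type*) [∀ n, MetricSpace (X n)] [∀ n, MeasurableSpace (X n)]
    (μ : ∀ n, Measure (X n)) (δ : ℝ) : Prop :=
  ∀ (N : ℕ) (κ : Fin (N + 1) → ℝ), 1 ≤ N → (∀ i, 0 < κ i) → ∑ i, κ i < 1 →
    ENNReal.ofReal δ ≤ liminf (fun n => separationDistance (μ n) κ) atTop

/-! Two subsets of $F^n$ at distance more than $\rho$ satisfy $4\mu(A)\mu(B)\le c$ with $c<1$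
independent of $n$; two masses slightly below $1/2$ then contradict dissipation. Cut $F$ into
finitely many small cells and call two cells adjacent when all their points are within $\rho$. Draw
two independent cells and average over both if they are adjacent, over the first alone otherwise.
Since $F$ is connected, the adjacency graph on charged cells is connected, and a Poincaré inequality
shows that this averaging contracts variance by some $c<1$
(`exists_varianceContracting_edgeMeasure`). The same $c$ survives in products
(`VarianceContracting.pi`), and for the sup metric a product of averages never charges two separated
sets at once (`VarianceContracting.four_mul_le`). -/

section FiniteProbability

variable {S T I J : Type*} [Fintype S] [Fintype T] [Fintype I] [Fintype J]

/-! ### Variance contraction and its tensorization. -/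

theorem sum_mul_sub_sq_eq (w : S → ℝ) (hw1 : ∑ s, w s = 1) (g : S → ℝ) :
    ∑ s, w s * (g s - ∑ t, w t * g t) ^ 2 = ∑ s, w s * g s ^ 2 - (∑ s, w s * g s) ^ 2 := by
  set e := ∑ t, w t * g t with he
  have h : ∀ s, w s * (g s - e) ^ 2 = w s * g s ^ 2 - 2 * e * (w s * g s) + e ^ 2 * w s :=
    fun s => by ring
  simp only [h, Finset.sum_add_distrib, Finset.sum_sub_distrib, ← Finset.mul_sum]
  rw [hw1, ← he]
  ring

theorem sq_sum_mul_le_sum_mul_sq (w : S → ℝ) (hw : ∀ s, 0 ≤ w s) (hw1 : ∑ s, w s = 1)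
    (g : S → ℝ) : (∑ s, w s * g s) ^ 2 ≤ ∑ s, w s * g s ^ 2 := by
  have h := sum_mul_sub_sq_eq w hw1 g
  have h' : 0 ≤ ∑ s, w s * (g s - ∑ t, w t * g t) ^ 2 :=
    Finset.sum_nonneg fun s _ => mul_nonneg (hw s) (sq_nonneg _)
  linarith

/-- The Efron–Stein inequality for two independent variables with finitely many values. -/
theorem efron_stein_two (w : S → ℝ) (v : T → ℝ) (hw : ∀ s, 0 ≤ w s) (hv : ∀ t, 0 ≤ v t)
    (hw1 : ∑ s, w s = 1) (hv1 : ∑ t, v t = 1) (f : S → T → ℝ) :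
    ∑ s, w s * (∑ t, v t * f s t) ^ 2 + ∑ t, v t * (∑ s, w s * f s t) ^ 2 ≤
      ∑ s, w s * ∑ t, v t * f s t ^ 2 + (∑ s, w s * ∑ t, v t * f s t) ^ 2 := by
  have hcomm : ∀ g : S → T → ℝ,
      ∑ s, w s * ∑ t, v t * g s t = ∑ t, v t * ∑ s, w s * g s t := by
    intro g
    simp only [Finset.mul_sum]
    rw [Finset.sum_comm]
    exact Finset.sum_congr rfl fun _ _ => Finset.sum_congr rfl fun _ _ => by ring
  have h1 := sum_mul_sub_sq_eq w hw1 fun s => ∑ t, v t * f s t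
  have h2 : ∀ s, (∑ t, v t * f s t - ∑ s', w s' * ∑ t, v t * f s' t) ^ 2 ≤
      ∑ t, v t * (f s t - ∑ s', w s' * f s' t) ^ 2 := by
    intro s
    rw [hcomm, ← Finset.sum_sub_distrib]
    simp only [← mul_sub]
    exact sq_sum_mul_le_sum_mul_sq v hv hv1 _
  have h3 := Finset.sum_le_sum fun s (_ : s ∈ Finset.univ) =>
    mul_le_mul_of_nonneg_left (h2 s) (hw s)
  rw [h1, hcomm fun s t => (f s t - ∑ s', w s' * f s' t) ^ 2] at h3
  have h4 : ∀ t, ∑ s, w s * (f s t - ∑ s', w s' * f s' t) ^ 2 =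
      ∑ s, w s * f s t ^ 2 - (∑ s, w s * f s t) ^ 2 :=
    fun t => sum_mul_sub_sq_eq w hw1 fun s => f s t
  simp only [h4, mul_sub, Finset.sum_sub_distrib] at h3
  rw [← hcomm fun s t => f s t ^ 2] at h3
  linarith

/-- Averaging against the measures `ν i` contracts the variance by the factor `c`. -/
def VarianceContracting (m : I → ℝ) (ν : I → S → ℝ) (w : S → ℝ) (c : ℝ) : Prop :=
  ∀ f : S → ℝ, ∑ i, m i * (∑ s, ν i s * f s) ^ 2 ≤
    c * ∑ s, w s * f s ^ 2 + (1 - c) * (∑ s, w s * f s) ^ 2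

/-- Contracting one factor and then the other leaves cross terms with coefficient $c(1-c)$.
Efron–Stein bounds them, and $c^2+c(1-c)=c$, $(1-c)^2+c(1-c)=1-c$. -/
theorem VarianceContracting.prod {m : I → ℝ} {ν : I → S → ℝ} {w : S → ℝ}
    {m' : J → ℝ} {ν' : J → T → ℝ} {v : T → ℝ} {c : ℝ}
    (h : VarianceContracting m ν w c) (h' : VarianceContracting m' ν' v c)
    (hw : ∀ s, 0 ≤ w s) (hv : ∀ t, 0 ≤ v t) (hm' : ∀ j, 0 ≤ m' j)
    (hw1 : ∑ s, w s = 1) (hv1 : ∑ t, v t = 1) (hc0 : 0 ≤ c) (hc1 : c ≤ 1) :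
    VarianceContracting (fun p : I × J => m p.1 * m' p.2)
      (fun p (q : S × T) => ν p.1 q.1 * ν' p.2 q.2) (fun q => w q.1 * v q.2) c := by
  intro f
  have hl : ∑ p : I × J, m p.1 * m' p.2 * (∑ q : S × T, ν p.1 q.1 * ν' p.2 q.2 * f q) ^ 2 =
      ∑ j, m' j * ∑ i, m i * (∑ s, ν i s * ∑ t, ν' j t * f (s, t)) ^ 2 := by
    simp only [Fintype.sum_prod_type, Finset.mul_sum]
    rw [Finset.sum_comm]
    simp only [← mul_assoc, mul_comm (m' _) (m _)]
  have hr : ∀ g : S × T → ℝ, ∑ q : S × T, w q.1 * v q.2 * g q =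
      ∑ s, w s * ∑ t, v t * g (s, t) := by
    intro g
    simp only [Fintype.sum_prod_type, Finset.mul_sum, mul_assoc]
  rw [hl, hr fun q => f q ^ 2, hr]
  have h1 := Finset.sum_le_sum fun j (_ : j ∈ Finset.univ) =>
    mul_le_mul_of_nonneg_left (h fun s => ∑ t, ν' j t * f (s, t)) (hm' j)
  have h2 := Finset.sum_le_sum fun s (_ : s ∈ Finset.univ) =>
    mul_le_mul_of_nonneg_left (h' fun t => f (s, t)) (hw s)
  have h3 := h' fun t => ∑ s, w s * f (s, t)
  have h4 := efron_stein_two w v hw hv hw1 hv1 fun s t => f (s, t)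
  have e1 : ∑ j, m' j * (c * ∑ s, w s * (∑ t, ν' j t * f (s, t)) ^ 2 +
      (1 - c) * (∑ s, w s * ∑ t, ν' j t * f (s, t)) ^ 2) =
      c * ∑ s, w s * ∑ j, m' j * (∑ t, ν' j t * f (s, t)) ^ 2 +
      (1 - c) * ∑ j, m' j * (∑ t, ν' j t * ∑ s, w s * f (s, t)) ^ 2 := by
    have e : ∀ j, ∑ s, w s * ∑ t, ν' j t * f (s, t) = ∑ t, ν' j t * ∑ s, w s * f (s, t) := by
      intro j
      simp only [Finset.mul_sum]
      rw [Finset.sum_comm]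
      exact Finset.sum_congr rfl fun _ _ => Finset.sum_congr rfl fun _ _ => by ring
    simp only [e, mul_add, Finset.sum_add_distrib]
    congr 1
    · simp only [Finset.mul_sum]
      rw [Finset.sum_comm]
      exact Finset.sum_congr rfl fun _ _ => Finset.sum_congr rfl fun _ _ => by ring
    · rw [Finset.mul_sum]
      exact Finset.sum_congr rfl fun _ _ => by ring
  have e2 : ∑ s, w s * (c * ∑ t, v t * f (s, t) ^ 2 + (1 - c) * (∑ t, v t * f (s, t)) ^ 2) =
      c * ∑ s, w s * ∑ t, v t * f (s, t) ^ 2 +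
      (1 - c) * ∑ s, w s * (∑ t, v t * f (s, t)) ^ 2 := by
    simp only [mul_add, Finset.sum_add_distrib]
    rw [Finset.mul_sum, Finset.mul_sum]
    congr 1 <;> exact Finset.sum_congr rfl fun _ _ => by ring
  have e3 : ∑ t, v t * ∑ s, w s * f (s, t) = ∑ s, w s * ∑ t, v t * f (s, t) := by
    simp only [Finset.mul_sum]
    rw [Finset.sum_comm]
    exact Finset.sum_congr rfl fun _ _ => Finset.sum_congr rfl fun _ _ => by ring
  rw [e1] at h1
  rw [e2] at h2
  rw [e3] at h3
  have h2' := mul_le_mul_of_nonneg_left h2 hc0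
  have h3' := mul_le_mul_of_nonneg_left h3 (sub_nonneg.2 hc1)
  have h4' := mul_le_mul_of_nonneg_left h4 (mul_nonneg hc0 (sub_nonneg.2 hc1))
  linarith

theorem sum_pi_prod_eq_one (w : S → ℝ) (hw1 : ∑ s, w s = 1) (n : ℕ) :
    ∑ s : Fin n → S, ∏ k, w (s k) = 1 := by
  rw [← Fintype.prod_sum fun (_ : Fin n) s => w s]
  simp only [hw1, Finset.prod_const_one]

theorem VarianceContracting.pi {m : I → ℝ} {ν : I → S → ℝ} {w : S → ℝ} {c : ℝ}
    (h : VarianceContracting m ν w c) (hw : ∀ s, 0 ≤ w s) (hm : ∀ i, 0 ≤ m i)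
    (hw1 : ∑ s, w s = 1) (hc0 : 0 ≤ c) (hc1 : c ≤ 1) (n : ℕ) :
    VarianceContracting (fun i : Fin n → I => ∏ k, m (i k))
      (fun i (s : Fin n → S) => ∏ k, ν (i k) (s k)) (fun s => ∏ k, w (s k)) c := by
  induction n with
  | zero =>
    intro f
    simp
    linarith
  | succ n ih =>
    intro f
    have hp := h.prod ih hw (fun s => Finset.prod_nonneg fun k _ => hw _)
      (fun s => Finset.prod_nonneg fun k _ => hm _) hw1 (sum_pi_prod_eq_one w hw1 n) hc0 hc1
      fun q => f (Fin.cons q.1 q.2)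
    have eS : ∀ g : (Fin (n + 1) → S) → ℝ,
        ∑ s, g s = ∑ q : S × (Fin n → S), g (Fin.cons q.1 q.2) :=
      fun g => (Equiv.sum_comp (Fin.consEquiv fun _ => S) g).symm
    have eI : ∀ g : (Fin (n + 1) → I) → ℝ,
        ∑ s, g s = ∑ q : I × (Fin n → I), g (Fin.cons q.1 q.2) :=
      fun g => (Equiv.sum_comp (Fin.consEquiv fun _ => I) g).symm
    simp only [eS, eI, Fin.prod_univ_succ, Fin.cons_zero, Fin.cons_succ]
    exact hp

/-- Two sets that are never charged by the same `ν i` cannot both be large. -/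
theorem VarianceContracting.four_mul_le {m : I → ℝ} {ν : I → S → ℝ} {w : S → ℝ} {c : ℝ}
    (h : VarianceContracting m ν w c) (hw : ∀ s, 0 ≤ w s) (hm : ∀ i, 0 ≤ m i)
    (hw1 : ∑ s, w s = 1) (hm1 : ∑ i, m i = 1) (hmν : ∀ s, ∑ i, m i * ν i s = w s)
    (hc0 : 0 ≤ c) (A B : Finset S)
    (hAB : ∀ i, ∀ s ∈ A, ∀ t ∈ B, ν i s * ν i t = 0) :
    4 * (∑ s ∈ A, w s) * (∑ s ∈ B, w s) ≤ c := by
  classical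
  -- For $f=1_A-1_B$, each average satisfies $(a_i-b_i)^2=(a_i+b_i)^2$ because $a_ib_i=0$. Jensen
  -- then gives $(a+b)^2\le c+(1-c)(a-b)^2$ for the total masses $a,b$.
  set f : S → ℝ := fun s => (if s ∈ A then 1 else 0) - (if s ∈ B then 1 else 0) with hf
  have hsum : ∀ u : S → ℝ, ∑ s, u s * f s = ∑ s ∈ A, u s - ∑ s ∈ B, u s := by
    intro u
    simp [hf, mul_sub, Finset.sum_sub_distrib]
  have hcross : ∀ i, (∑ s ∈ A, ν i s) * ∑ t ∈ B, ν i t = 0 := by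
    intro i
    rw [Finset.sum_mul_sum]
    exact Finset.sum_eq_zero fun s hs => Finset.sum_eq_zero fun t ht => hAB i s hs t ht
  have hmA : ∀ A : Finset S, ∑ i, m i * ∑ s ∈ A, ν i s = ∑ s ∈ A, w s := by
    intro A
    simp only [Finset.mul_sum]
    rw [Finset.sum_comm]
    exact Finset.sum_congr rfl fun s _ => hmν s
  have h1 := h f
  simp only [hsum] at h1
  have h2 : ∀ i, (∑ s ∈ A, ν i s - ∑ s ∈ B, ν i s) ^ 2 =
      (∑ s ∈ A, ν i s + ∑ s ∈ B, ν i s) ^ 2 := fun i => by linarith [hcross i]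
  simp only [h2] at h1
  have h3 := sq_sum_mul_le_sum_mul_sq m hm hm1 fun i => ∑ s ∈ A, ν i s + ∑ s ∈ B, ν i s
  simp only [mul_add, Finset.sum_add_distrib, hmA] at h3
  have h4 : ∑ s, w s * f s ^ 2 ≤ 1 := by
    rw [← hw1]
    refine Finset.sum_le_sum fun s _ => mul_le_of_le_one_right (hw s) ?_
    simp only [hf]
    split_ifs <;> norm_num
  have h5 := mul_le_mul_of_nonneg_left h4 hc0
  nlinarith [mul_nonneg hc0 (sq_nonneg (∑ s ∈ A, w s - ∑ s ∈ B, w s))]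

/-! ### Poincaré inequality on a finite weighted graph. -/

theorem exists_sq_sub_le_mul_dirichlet (w : S → ℝ) (hw : ∀ s, 0 ≤ w s) (r : S → S → Prop)
    [DecidableRel r] {a b : S}
    (hab : Relation.ReflTransGen (fun s t => r s t ∧ 0 < w s ∧ 0 < w t) a b) :
    ∃ C : ℝ, 0 ≤ C ∧ ∀ f : S → ℝ, (f a - f b) ^ 2 ≤
      C * ∑ s, ∑ t, if r s t then w s * w t * (f s - f t) ^ 2 else 0 := by
  have hnn : ∀ (f : S → ℝ) s t, 0 ≤ if r s t then w s * w t * (f s - f t) ^ 2 else 0 := by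
    intro f s t
    split_ifs
    · exact mul_nonneg (mul_nonneg (hw s) (hw t)) (sq_nonneg _)
    · exact le_rfl
  induction hab with
  | refl => exact ⟨0, le_rfl, fun f => by simp⟩
  | @tail x y _ hxy ih =>
    obtain ⟨C, hC, hf⟩ := ih
    obtain ⟨hr, hx, hy⟩ := hxy
    have hpos : 0 < w x * w y := mul_pos hx hy
    -- From $(u+v)^2\le 2u^2+2v^2$, with the new edge controlled by its own term of the Dirichlet
    -- sum.
    refine ⟨2 * C + 2 * (w x * w y)⁻¹, by positivity, fun f => ?_⟩
    set D := ∑ s, ∑ t, if r s t then w s * w t * (f s - f t) ^ 2 else 0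
    have h1 : w x * w y * (f x - f y) ^ 2 ≤ D := by
      calc w x * w y * (f x - f y) ^ 2
          = if r x y then w x * w y * (f x - f y) ^ 2 else 0 := by simp [hr]
        _ ≤ ∑ t, if r x t then w x * w t * (f x - f t) ^ 2 else 0 :=
          Finset.single_le_sum (f := fun t => if r x t then w x * w t * (f x - f t) ^ 2 else 0)
            (fun t _ => hnn f x t) (Finset.mem_univ y)
        _ ≤ D := Finset.single_le_sum
            (f := fun s => ∑ t, if r s t then w s * w t * (f s - f t) ^ 2 else 0)
            (fun s _ => Finset.sum_nonneg fun t _ => hnn f s t) (Finset.mem_univ x)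
    have h2 : (f x - f y) ^ 2 ≤ (w x * w y)⁻¹ * D := by
      rw [inv_mul_eq_div, le_div_iff₀ hpos]
      linarith
    have h3 := hf f
    nlinarith [sq_nonneg ((f a - f x) - (f x - f y))]

/-- The uniform measure on `{i, j}` if `r i j`, and the point mass at `i` otherwise. -/
noncomputable def edgeMeasure [DecidableEq S] (r : S → S → Prop) [DecidableRel r] (p : S × S)
    (s : S) : ℝ :=
  if r p.1 p.2 then ((if p.1 = s then 1 else 0) + (if p.2 = s then 1 else 0)) / 2
  else if p.1 = s then 1 else 0

theorem sum_edgeMeasure_mul [DecidableEq S] (r : S → S → Prop) [DecidableRel r] (p : S × S)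
    (f : S → ℝ) : ∑ s, edgeMeasure r p s * f s =
      if r p.1 p.2 then (f p.1 + f p.2) / 2 else f p.1 := by
  unfold edgeMeasure
  split_ifs with h
  · simp [add_div, add_mul, Finset.sum_add_distrib, ite_div, ite_mul]
    ring
  · simp

/-- By symmetry of $r$, the half masses moved from $i$ to $j$ and from $j$ to $i$ balance, so $w$ is
stationary. -/
theorem sum_mul_edgeMeasure [DecidableEq S] (r : S → S → Prop) [DecidableRel r]
    (hr : ∀ s t, r s t → r t s) (w : S → ℝ) (hw1 : ∑ s, w s = 1) (s : S) :
    ∑ p : S × S, w p.1 * w p.2 * edgeMeasure r p s = w s := by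
  have hr' : ∀ s t, r s t ↔ r t s := fun s t => ⟨hr s t, hr t s⟩
  have key : ∑ i, ∑ j, w i * w j * (if r i j then (if j = s then 1 else 0) else 0 : ℝ) =
      ∑ i, ∑ j, w i * w j * (if r i j then (if i = s then 1 else 0) else 0 : ℝ) := by
    rw [Finset.sum_comm]
    refine Finset.sum_congr rfl fun i _ => Finset.sum_congr rfl fun j _ => ?_
    simp only [mul_comm (w j), hr' j i]
  have e : ∀ i j, w i * w j * edgeMeasure r (i, j) s = w i * w j * (if i = s then 1 else 0) +
      (w i * w j * (if r i j then (if j = s then 1 else 0) else 0) -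
        w i * w j * (if r i j then (if i = s then 1 else 0) else 0)) / 2 := by
    intro i j
    unfold edgeMeasure
    by_cases h : r i j
    · simp only [h, if_true]
      ring
    · simp only [h, if_false]
      ring
  rw [Fintype.sum_prod_type]
  simp only [e, Finset.sum_add_distrib, ← Finset.sum_div, Finset.sum_sub_distrib, key]
  simp [← Finset.mul_sum, hw1]

theorem adj_of_edgeMeasure_ne_zero {V : Type*} [DecidableEq V] {r : V → V → Prop} [DecidableRel r]
    (hsymm : ∀ s t, r s t → r t s) (hrefl : ∀ s, r s s) {p : V × V} {s t : V}
    (hs : edgeMeasure r p s ≠ 0) (ht : edgeMeasure r p t ≠ 0) : r s t := by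
  obtain ⟨i, j⟩ := p
  have h : ∀ u, edgeMeasure r (i, j) u ≠ 0 → i = u ∨ r i j ∧ j = u := by
    intro u hu
    by_contra! hcon
    apply hu
    unfold edgeMeasure
    by_cases hij : r i j
    · simp [hij, hcon.1, hcon.2 hij]
    · simp [hij, hcon.1]
  rcases h s hs with rfl | ⟨hij, rfl⟩ <;> rcases h t ht with rfl | ⟨hij', rfl⟩
  · exact hrefl _
  · exact hij'
  · exact hsymm _ _ hij
  · exact hrefl _

theorem exists_varianceContracting_edgeMeasure [DecidableEq S] (r : S → S → Prop)
    [DecidableRel r] (hr : ∀ s t, r s t → r t s) (w : S → ℝ) (hw : ∀ s, 0 ≤ w s)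
    (hw1 : ∑ s, w s = 1)
    (hconn : ∀ a b, 0 < w a → 0 < w b →
      Relation.ReflTransGen (fun s t => r s t ∧ 0 < w s ∧ 0 < w t) a b) :
    ∃ c : ℝ, 0 ≤ c ∧ c < 1 ∧
      VarianceContracting (fun p : S × S => w p.1 * w p.2) (edgeMeasure r) w c := by
  have hr' : ∀ s t, r s t ↔ r t s := fun s t => ⟨hr s t, hr t s⟩
  have hex : ∀ a b, ∃ C : ℝ, 0 ≤ C ∧ ∀ f : S → ℝ, w a * w b * (f a - f b) ^ 2 ≤
      C * ∑ s, ∑ t, if r s t then w s * w t * (f s - f t) ^ 2 else 0 := by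
    intro a b
    by_cases h : 0 < w a ∧ 0 < w b
    · obtain ⟨C, hC, hf⟩ := exists_sq_sub_le_mul_dirichlet w hw r (hconn a b h.1 h.2)
      refine ⟨w a * w b * C, mul_nonneg (mul_nonneg (hw a) (hw b)) hC, fun f => ?_⟩
      rw [mul_assoc (w a * w b)]
      exact mul_le_mul_of_nonneg_left (hf f) (mul_nonneg (hw a) (hw b))
    · refine ⟨0, le_rfl, fun f => ?_⟩
      have : w a * w b = 0 := by
        rcases not_and_or.1 h with h | h
        · rw [le_antisymm (not_lt.1 h) (hw a), zero_mul]
        · rw [le_antisymm (not_lt.1 h) (hw b), mul_zero]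
      simp [this]
  choose C hC hCf using hex
  set K : ℝ := 1 + ∑ a, ∑ b, C a b with hK
  have hK1 : 1 ≤ K := by
    have : 0 ≤ ∑ a, ∑ b, C a b :=
      Finset.sum_nonneg fun a _ => Finset.sum_nonneg fun b _ => hC a b
    linarith
  -- Averaging lowers the second moment by exactly $D/4$, and Poincaré gives $2\operatorname{Var}\le
  -- KD$; hence a drop of at least $\operatorname{Var}/(2K)$. The summand 1 in $K$ keeps $c\ge 0$.
  refine ⟨1 - 1 / (2 * K), ?_, ?_, fun f => ?_⟩
  · have : 1 / (2 * K) ≤ 1 := by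
      rw [div_le_one (by linarith)]
      linarith
    linarith
  · have : 0 < 1 / (2 * K) := by positivity
    linarith
  set D := ∑ s, ∑ t, if r s t then w s * w t * (f s - f t) ^ 2 else 0 with hD
  have hD0 : 0 ≤ D := Finset.sum_nonneg fun s _ => Finset.sum_nonneg fun t _ => by
    split_ifs
    · exact mul_nonneg (mul_nonneg (hw s) (hw t)) (sq_nonneg _)
    · exact le_rfl
  have hvar : ∑ a, ∑ b, w a * w b * (f a - f b) ^ 2 =
      2 * (∑ s, w s * f s ^ 2 - (∑ s, w s * f s) ^ 2) := by
    have e : ∀ a b, w a * w b * (f a - f b) ^ 2 =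
        w a * f a ^ 2 * w b + w b * f b ^ 2 * w a - 2 * (w a * f a * (w b * f b)) :=
      fun a b => by ring
    simp only [e, Finset.sum_add_distrib, Finset.sum_sub_distrib, ← Finset.mul_sum,
      ← Finset.sum_mul, hw1]
    ring
  have hpoinc : 2 * (∑ s, w s * f s ^ 2 - (∑ s, w s * f s) ^ 2) ≤ K * D := by
    rw [← hvar]
    calc ∑ a, ∑ b, w a * w b * (f a - f b) ^ 2 ≤ ∑ a, ∑ b, C a b * D :=
          Finset.sum_le_sum fun a _ => Finset.sum_le_sum fun b _ => hCf a b f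
      _ = (∑ a, ∑ b, C a b) * D := by simp only [Finset.sum_mul]
      _ ≤ K * D := mul_le_mul_of_nonneg_right (by linarith) hD0
  have key : ∑ i, ∑ j, (if r i j then w i * w j * f j ^ 2 else 0) =
      ∑ i, ∑ j, (if r i j then w i * w j * f i ^ 2 else 0) := by
    rw [Finset.sum_comm]
    refine Finset.sum_congr rfl fun i _ => Finset.sum_congr rfl fun j _ => ?_
    simp only [mul_comm (w j), hr' j i]
  have e : ∀ i j, w i * w j * (if r i j then (f i + f j) / 2 else f i) ^ 2 =
      w i * f i ^ 2 * w j + ((if r i j then w i * w j * f j ^ 2 else 0) -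
        (if r i j then w i * w j * f i ^ 2 else 0)) / 2 -
      (if r i j then w i * w j * (f i - f j) ^ 2 else 0) / 4 := by
    intro i j
    split_ifs <;> ring
  have hT : ∑ p : S × S, w p.1 * w p.2 * (∑ s, edgeMeasure r p s * f s) ^ 2 =
      ∑ s, w s * f s ^ 2 - D / 4 := by
    simp only [sum_edgeMeasure_mul]
    rw [Fintype.sum_prod_type]
    simp only [e, Finset.sum_add_distrib, Finset.sum_sub_distrib, ← Finset.sum_div, key]
    simp [← Finset.mul_sum, hw1, hD]
  rw [hT]
  have h6 : 1 / (2 * K) * (∑ s, w s * f s ^ 2 - (∑ s, w s * f s) ^ 2) ≤ D / 4 := by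
    rw [one_div, inv_mul_le_iff₀ (by linarith)]
    linarith
  linarith

end FiniteProbability


/-! ### Discretization of the space into cells. -/

section Discretization

theorem exists_simpleFunc_dist_lt {F : Type*} [MetricSpace F] [CompactSpace F] [Nonempty F]
    [MeasurableSpace F] [BorelSpace F] {ε : ℝ} (hε : 0 < ε) :
    ∃ φ : SimpleFunc F F, ∀ x, dist (φ x) x < ε := by
  let e : ℕ → F := TopologicalSpace.denseSeq F
  have hcov : (Set.univ : Set F) ⊆ ⋃ k, Metric.ball (e k) ε := by
    intro x _
    obtain ⟨k, hk⟩ := (TopologicalSpace.denseRange_denseSeq F).exists_dist_lt x hε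
    exact Set.mem_iUnion.2 ⟨k, hk⟩
  obtain ⟨t, ht⟩ := isCompact_univ.elim_finite_subcover _ (fun k => Metric.isOpen_ball) hcov
  refine ⟨SimpleFunc.nearestPt e (t.sup id), fun x => ?_⟩
  obtain ⟨k, hk, hx⟩ := Set.mem_iUnion₂.1 (ht (Set.mem_univ x))
  have h := SimpleFunc.edist_nearestPt_le e x (Finset.le_sup (f := id) hk)
  rw [edist_dist, edist_dist, ENNReal.ofReal_le_ofReal_iff dist_nonneg] at h
  exact h.trans_lt (Metric.mem_ball'.1 hx)

/-- In a finite closed cover of a connected space by nonempty sets, any two members are joined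
by a chain of members in which consecutive ones intersect. -/
theorem reflTransGen_of_finite_closed_cover {F S : Type*} [TopologicalSpace F]
    [PreconnectedSpace F] [Finite S] (p : S → Prop) (C : S → Set F) (hC : ∀ s, IsClosed (C s))
    (hne : ∀ s, p s → (C s).Nonempty) (hcov : ∀ x, ∃ s, p s ∧ x ∈ C s) {a b : S}
    (ha : p a) (hb : p b) :
    Relation.ReflTransGen (fun s t => (C s ∩ C t).Nonempty ∧ p s ∧ p t) a b := by
  set R := Relation.ReflTransGen (fun s t => (C s ∩ C t).Nonempty ∧ p s ∧ p t) a with hR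
  by_contra hab
  have hclosed : ∀ q : S → Prop, IsClosed (⋃ s ∈ {s | q s}, C s) := fun q =>
    (Set.toFinite {s | q s}).isClosed_biUnion fun s _ => hC s
  -- The members reachable from $a$ and the unreachable ones form two closed sets covering the
  -- space; a common point would extend a chain to an unreachable member.
  have h := isPreconnected_closed_iff.1 (isPreconnected_univ (α := F)) _ _
    (hclosed fun s => p s ∧ R s) (hclosed fun s => p s ∧ ¬ R s) ?_ ?_ ?_
  · obtain ⟨x, -, h1, h2⟩ := h
    obtain ⟨s, ⟨hs, hRs⟩, hxs⟩ := Set.mem_iUnion₂.1 h1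
    obtain ⟨t, ⟨ht, hRt⟩, hxt⟩ := Set.mem_iUnion₂.1 h2
    exact hRt (hRs.tail ⟨⟨x, hxs, hxt⟩, hs, ht⟩)
  · intro x _
    obtain ⟨s, hs, hx⟩ := hcov x
    by_cases hRs : R s
    · exact Or.inl (Set.mem_iUnion₂.2 ⟨s, ⟨hs, hRs⟩, hx⟩)
    · exact Or.inr (Set.mem_iUnion₂.2 ⟨s, ⟨hs, hRs⟩, hx⟩)
  · obtain ⟨x, hx⟩ := hne a ha
    exact ⟨x, trivial, Set.mem_iUnion₂.2 ⟨a, ⟨ha, Relation.ReflTransGen.refl⟩, hx⟩⟩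
  · obtain ⟨x, hx⟩ := hne b hb
    exact ⟨x, trivial, Set.mem_iUnion₂.2 ⟨b, ⟨hb, hab⟩, hx⟩⟩

variable {F : Type*} [MetricSpace F] [MeasurableSpace F]

/-- Otherwise $x$ has an open neighbourhood covered by finitely many null fibres, against full
support. -/
theorem exists_mem_closure_fiber [BorelSpace F] (μ : Measure F) [μ.IsOpenPosMeasure]
    (φ : SimpleFunc F F) (x : F) :
    ∃ s : φ.range, 0 < μ (φ ⁻¹' {(s : F)}) ∧ x ∈ closure (φ ⁻¹' {(s : F)}) := by
  by_contra! h
  set U : Set F := ⋂ s ∈ {s : φ.range | 0 < μ (φ ⁻¹' {(s : F)})},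
    (closure (φ ⁻¹' {(s : F)}))ᶜ with hU
  have hUo : IsOpen U :=
    (Set.toFinite _).isOpen_biInter fun s _ => isClosed_closure.isOpen_compl
  have hxU : x ∈ U := Set.mem_iInter₂.2 fun s hs => h s hs
  have hpos : 0 < μ U := hUo.measure_pos μ ⟨x, hxU⟩
  have hsub : U ⊆ ⋃ s ∈ {s : φ.range | ¬ 0 < μ (φ ⁻¹' {(s : F)})}, φ ⁻¹' {(s : F)} := by
    intro y hy
    refine Set.mem_iUnion₂.2 ⟨⟨φ y, φ.mem_range_self y⟩, fun hp => ?_, rfl⟩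
    exact Set.mem_iInter₂.1 hy _ hp (subset_closure rfl)
  have hzero : μ (⋃ s ∈ {s : φ.range | ¬ 0 < μ (φ ⁻¹' {(s : F)})}, φ ⁻¹' {(s : F)}) = 0 :=
    (measure_biUnion_null_iff (Set.to_countable _)).2 fun s hs =>
      le_antisymm (not_lt.1 hs) bot_le
  exact hpos.ne' (measure_mono_null hsub hzero)

/-- Two subsets of a power of a connected compact space at distance more than `ρ` satisfy
`4 μ(A) μ(B) ≤ c` for some `c < 1` that does not depend on the exponent. -/
theorem exists_four_mul_le_of_separated [CompactSpace F] [ConnectedSpace F] [BorelSpace F]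
    (μ : Measure F) [IsProbabilityMeasure μ] [μ.IsOpenPosMeasure] {ρ : ℝ} (hρ : 0 < ρ) :
    ∃ c : ℝ, 0 ≤ c ∧ c < 1 ∧ ∀ (n : ℕ) (A B : Set (Fin n → F)),
      (∀ x ∈ A, ∀ y ∈ B, ρ < dist x y) →
      4 * (Measure.pi fun _ => μ).real A * (Measure.pi fun _ => μ).real B ≤ c := by
  classical
  -- With $\rho/4$, points of two cells whose closures share $z$ are joined through the two centres
  -- and $z$ by four steps of length at most $\rho/4$, so touching cells are adjacent.
  obtain ⟨φ, hφ⟩ := exists_simpleFunc_dist_lt (F := F) (ε := ρ / 4) (by linarith)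
  let r : φ.range → φ.range → Prop := fun s t => ∀ x y, φ x = s → φ y = t → dist x y ≤ ρ
  let w : φ.range → ℝ := fun s => μ.real (φ ⁻¹' {(s : F)})
  have hrsymm : ∀ s t, r s t → r t s := fun s t h x y hx hy => by
    rw [dist_comm]
    exact h y x hy hx
  have hrrefl : ∀ s, r s s := fun s x y hx hy => by
    have h1 := hφ x
    have h2 := hφ y
    rw [hx] at h1
    rw [hy] at h2
    have := dist_triangle_left x y (s : F)
    linarith
  have hw : ∀ s, 0 ≤ w s := fun s => measureReal_nonneg
  have hw1 : ∑ s, w s = 1 := by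
    have h := sum_measureReal_preimage_singleton (μ := μ) φ.range (f := φ)
      (fun y _ => φ.measurableSet_preimage {y})
    have hu : φ ⁻¹' (φ.range : Set F) = Set.univ := by
      ext x
      simp
    rw [hu, probReal_univ] at h
    rw [← h]
    exact Finset.sum_coe_sort φ.range fun y => μ.real (φ ⁻¹' {y})
  have hpos : ∀ s, 0 < w s ↔ 0 < μ (φ ⁻¹' {(s : F)}) := fun s => by
    simp [w, measureReal_def, ENNReal.toReal_pos_iff]
  have hconn : ∀ a b, 0 < w a → 0 < w b →
      Relation.ReflTransGen (fun s t => r s t ∧ 0 < w s ∧ 0 < w t) a b := by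
    intro a b ha hb
    refine Relation.ReflTransGen.mono ?_ _ _ (reflTransGen_of_finite_closed_cover
      (fun s => 0 < w s) (fun s : φ.range => closure (φ ⁻¹' {(s : F)}))
      (fun _ => isClosed_closure) ?_ ?_ ha hb)
    rotate_left
    · intro s hs
      exact (nonempty_of_measure_ne_zero ((hpos s).1 hs).ne').closure
    · intro x
      obtain ⟨s, hs, hx⟩ := exists_mem_closure_fiber μ φ x
      exact ⟨s, (hpos s).2 hs, hx⟩
    · rintro s t ⟨⟨z, hzs, hzt⟩, hs, ht⟩
      refine ⟨fun x y hx hy => ?_, hs, ht⟩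
      have hcl : ∀ u : φ.range, z ∈ closure (φ ⁻¹' {(u : F)}) → dist (u : F) z ≤ ρ / 4 := by
        intro u hz
        refine Metric.mem_closedBall'.1 (closure_minimal ?_ Metric.isClosed_closedBall hz)
        intro v hv
        have := hφ v
        rw [show φ v = u from hv] at this
        exact Metric.mem_closedBall'.2 this.le
      have h1 := hφ x
      have h2 := hφ y
      rw [hx] at h1
      rw [hy] at h2
      have h3 := hcl s hzs
      have h4 := hcl t hzt
      have h5 := dist_triangle4_left (s : F) z x z
      have h6 := dist_triangle_left x z (s : F)
      have h7 := dist_triangle_left y z (t : F)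
      have h8 := dist_triangle_right x y z
      linarith
  obtain ⟨c, hc0, hc1, hc⟩ :=
    exists_varianceContracting_edgeMeasure r hrsymm w hw hw1 hconn
  refine ⟨c, hc0, hc1, fun n A B hAB => ?_⟩
  let L : (Fin n → F) → Fin n → φ.range := fun x k => ⟨φ (x k), φ.mem_range_self _⟩
  -- Replacing a set by all the cells it meets only increases its mass, so arbitrary sets reduce to
  -- finite sets of cells.
  have hmeas : ∀ A : Set (Fin n → F), (Measure.pi fun _ => μ).real A ≤
      ∑ s ∈ (L '' A).toFinset, ∏ k, w (s k) := by
    intro A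
    have hsub : A ⊆ ⋃ s ∈ (L '' A).toFinset, Set.univ.pi fun k => φ ⁻¹' {(s k : F)} := by
      intro x hx
      refine Set.mem_iUnion₂.2 ⟨L x, Set.mem_toFinset.2 ⟨x, hx, rfl⟩, fun k _ => ?_⟩
      simp [L]
    refine (measureReal_mono hsub (measure_ne_top _ _)).trans ((measureReal_biUnion_finset_le _ _).trans_eq ?_)
    refine Finset.sum_congr rfl fun s _ => ?_
    simp [measureReal_def, Measure.pi_pi, ENNReal.toReal_prod, w]
  have hpi := hc.pi hw (fun p => mul_nonneg (hw _) (hw _)) hw1 hc0 hc1.le n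
  have hm1 : ∑ p : φ.range × φ.range, w p.1 * w p.2 = 1 := by
    rw [Fintype.sum_prod_type]
    simp only [← Finset.mul_sum, hw1, mul_one]
  have h4 := hpi.four_mul_le (fun s => Finset.prod_nonneg fun k _ => hw _)
    (fun i => Finset.prod_nonneg fun k _ => mul_nonneg (hw _) (hw _))
    (sum_pi_prod_eq_one w hw1 n) ?_ ?_ hc0
    (L '' A).toFinset (L '' B).toFinset ?_
  · refine le_trans ?_ h4
    have hA := hmeas A
    have hB := hmeas B
    have hA0 : 0 ≤ (Measure.pi fun _ : Fin n => μ).real A := measureReal_nonneg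
    have hB0 : 0 ≤ (Measure.pi fun _ : Fin n => μ).real B := measureReal_nonneg
    gcongr
  · exact sum_pi_prod_eq_one (fun p : φ.range × φ.range => w p.1 * w p.2) hm1 n
  · intro s
    simp only [← Finset.prod_mul_distrib]
    rw [← Fintype.prod_sum fun (k : Fin n) (p : φ.range × φ.range) =>
      w p.1 * w p.2 * edgeMeasure r p (s k)]
    exact Finset.prod_congr rfl fun k _ => sum_mul_edgeMeasure r hrsymm w hw1 (s k)
  · intro i s hs t ht
    obtain ⟨x, hx, rfl⟩ := Set.mem_toFinset.1 hs
    obtain ⟨y, hy, rfl⟩ := Set.mem_toFinset.1 ht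
    by_contra hne
    -- If one product average charges both cells, they are adjacent in every coordinate, which for
    -- the sup metric forces distance at most $\rho$.
    refine (hAB x hx y hy).not_ge ((dist_pi_le_iff hρ.le).2 fun k => ?_)
    have hx1 := Finset.prod_ne_zero_iff.1 (left_ne_zero_of_mul hne) k (Finset.mem_univ k)
    have hy1 := Finset.prod_ne_zero_iff.1 (right_ne_zero_of_mul hne) k (Finset.mem_univ k)
    refine adj_of_edgeMeasure_ne_zero hrsymm hrrefl hx1 hy1 (x k) (y k) rfl rfl

end Discretization

/-! ### From separated sets to non-dissipation. -/

theorem separationDistance_pair_le {X : Type*} [MetricSpace X] [MeasurableSpace X]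
    (μ : Measure X) [IsFiniteMeasure μ] {κ ρ : ℝ}
    (h : ∀ A B : Set X, κ ≤ μ.real A → κ ≤ μ.real B → ∃ x ∈ A, ∃ y ∈ B, dist x y ≤ ρ) :
    separationDistance μ (fun _ : Fin (1 + 1) => κ) ≤ ENNReal.ofReal ρ := by
  refine iSup₂_le fun A hA => ?_
  have hκ : ∀ i, κ ≤ μ.real (A i) := fun i =>
    (ENNReal.ofReal_le_iff_le_toReal (measure_ne_top _ _)).1 (hA i).2
  obtain ⟨x, hx, y, hy, hxy⟩ := h (A 0) (A 1) (hκ 0) (hκ 1)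
  refine (iInf₂_le 0 1).trans ((iInf_le _ (by decide)).trans ?_)
  refine (iInf₂_le x hx).trans ((iInf₂_le y hy).trans ?_)
  rw [edist_dist]
  exact ENNReal.ofReal_le_ofReal hxy

/-- The powers of a compact, connected, locally connected metric measure space with full support
do not dissipate. The metric on `Fin (n + 1) → F` is the sup (that is, `l_∞`) metric, and
`Measure.pi` is the product measure. -/
theorem mainTheorem7 {F : Type*} [MetricSpace F] [CompactSpace F] [ConnectedSpace F]
    [LocallyConnectedSpace F] [MeasurableSpace F] [BorelSpace F]
    (μ : Measure F) [IsProbabilityMeasure μ] [μ.IsOpenPosMeasure]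
    (δ : ℝ) (hδ : 0 < δ) :
    ¬ Dissipates (fun n : ℕ => Fin (n + 1) → F)
        (fun n : ℕ => Measure.pi (fun _ : Fin (n + 1) => μ)) δ := by
  intro hdiss
  obtain ⟨c, hc0, hc1, hc⟩ := exists_four_mul_le_of_separated μ (half_pos hδ)
  -- Both masses equal $\kappa=(1+c)/4$: their sum $(1+c)/2$ is below 1, while
  -- $4\kappa^2-c=(1-c)^2/4>0$.
  have hκ := hdiss 1 (fun _ => (1 + c) / 4) le_rfl (fun _ => by linarith) (by
    rw [Fin.sum_univ_two]
    linarith)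
  have hsep : ∀ n : ℕ, separationDistance (Measure.pi fun _ : Fin (n + 1) => μ)
      (fun _ : Fin (1 + 1) => (1 + c) / 4) ≤ ENNReal.ofReal (δ / 2) := by
    intro n
    refine separationDistance_pair_le _ fun A B hA hB => ?_
    by_contra! hAB
    have h := hc (n + 1) A B hAB
    nlinarith [mul_le_mul hA hB (by linarith) measureReal_nonneg, sq_pos_of_pos (sub_pos.2 hc1)]
  have hlim := hκ.trans (liminf_le_liminf (Eventually.of_forall hsep))
  rw [liminf_const, ENNReal.ofReal_le_ofReal_iff (half_pos hδ).le] at hlim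
  linarith
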